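/- Let $k$ be an algebraically closed field, $m\ge 2$, $R=k[X_0,\dots,X_m]$, and let $f_0,\dots,f_n\in R$ be homogeneous polynomials of the same degree $d$ which form a minimal generating set of the ideal $I=(f_0,\dots,f_n)$ and satisfy $\gcd(f_0,\dots,f_n)=1$. Assume that the rational map $\phi=(f_0:\dots:f_n):\mathbb{P}^m_k\dashrightarrow\mathbb{P}^n_k$ is generically finite onto its image, i.e. that its closed image has dimension $m$. Let $J(\mathbf f)=(\partial f_i/\partial X_j)$ be the Jacobian matrix and $I_3(J(\mathbf f))$ the ideal generated by its $3\times 3$ minors. Assume $I_3(J(\mathbf f))\ne 0$ and let $F$ be the greatest common divisor of the $3\times3$ minors of $J(\mathbf f)$. Let $\Gamma\subset\mathbb{P}^m_k\times\mathbb{P}^n_k$ be the closure of the graph of $\phi$, i.e. the subscheme defined by the Rees algebra $\mathcal R_I=\bigoplus_{s\ge0}I^s$, let $\pi:\Gamma\to\mathbb{P}^n_k$ be the second projection, and for a closed point $y\in\mathbb{P}^n_k$ with residue field $k(y)\cong k$ let $\pi^{-1}(y)=\operatorname{Proj}(\mathcal R_I\otimes_{k[T_0,\dots,T_n]}k(y))\subset\mathbb{P}^m_k$,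 where $T_i$ acts on $\mathcal R_I$ as $f_i$ placed in degree one. Let $\mathcal Y_{m-1}$ be the set of closed points $y$ with $\dim\pi^{-1}(y)=m-1$. Then: 1. $\mathcal Y_{m-1}$ is finite, and for every $y\in\mathcal Y_{m-1}$ the unmixed part of dimension $m-1$ of $\pi^{-1}(y)$ (that is, the intersection of the primary components of maximal dimension of its defining ideal) is defined by one non-zero homogeneous polynomial $h_y\in R$, unique up to a constant factor. 2. If $h_y=\prod_{i=1}^{r_y}h_{y,i}^{e_{y,i}}$ is the factorization of $h_y$ into powers, with exponents $e_{y,i}\ge1$, of pairwise non-associated irreducible polynomials, then $$\sum_{y\in\mathcal Y_{m-1}}\deg h_y\ \le\ \sum_{y\in\mathcal Y_{m-1}}\sum_{i=1}^{r_y}(2e_{y,i}-1)\deg h_{y,i}\ \le\ \deg F\ \le\ 3(d-1).$$ -/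

import Mathlib

open MvPolynomial

noncomputable section

/-- `g` is a greatest common divisor of the elements of `S` (it is unique up to units). -/
def IsGCDOf {R : Type*} [CommRing R] (S : Set R) (g : R) : Prop :=
  (∀ s ∈ S, g ∣ s) ∧ ∀ c : R, (∀ s ∈ S, c ∣ s) → c ∣ g

/-- `h = ∏ i, q i ^ e i` is an irreducible factorization: the `q i` are irreducible and pairwise
non-associated, and the exponents are positive. -/
structure IsIrreducibleFactorization {R : Type*} [CommRing R] {r : ℕ}
    (h : R) (q : Fin r → R) (e : Fin r → ℕ) : Prop where
  irreducible : ∀ i, Irreducible (q i)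
  not_associated : ∀ i j, i ≠ j → ¬ Associated (q i) (q j)
  exponent_pos : ∀ i, 0 < e i
  eq_prod : h = ∏ i, q i ^ e i

/-- No member of the family `f` lies in the ideal generated by the others, that is, `f` is a minimal
generating set of the ideal it generates. -/
def IsMinimalGenerating {R ι : Type*} [CommRing R] (f : ι → R) : Prop :=
  ∀ i, f i ∉ Ideal.span (f '' {j | j ≠ i})

/-- The set of `s`-minors of a matrix. -/
def minorSet {R : Type*} [CommRing R] {a b : ℕ} (s : ℕ) (M : Matrix (Fin a) (Fin b) R) : Set R :=
  Set.range fun rc : (Fin s ↪o Fin a) × (Fin s ↪o Fin b) => (M.submatrix rc.1 rc.2).det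

/-- The ideal `I_s(M)` generated by the `s`-minors of a matrix `M`. -/
def minorIdeal {R : Type*} [CommRing R] {a b : ℕ} (s : ℕ) (M : Matrix (Fin a) (Fin b) R) :
    Ideal R :=
  Ideal.span (minorSet s M)

/-- The unmixed part (of maximal dimension) of an ideal `J`: the intersection of the primary
components of `J` at those primes `P ⊇ J` with `dim R/P = dim R/J`. Such a `P` is a minimal prime of
`J` (when the dimension is finite), and its primary component is the contraction of `J R_P`. -/
def unmixedPart {R : Type*} [CommRing R] (J : Ideal R) : Ideal R :=
  ⨅ P : {P : PrimeSpectrum R //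
      J ≤ P.asIdeal ∧ ringKrullDim (R ⧸ P.asIdeal) = ringKrullDim (R ⧸ J)},
    (J.map (algebraMap R (Localization.AtPrime P.1.asIdeal))).comap
      (algebraMap R (Localization.AtPrime P.1.asIdeal))

attribute [local instance] MvPolynomial.gradedAlgebra

variable {k : Type*} [Field k]

/-- The dimension of the closed subscheme `Proj (k[X_0, …, X_m] / J)` of `ℙ^m` defined by a
homogeneous ideal `J`: the Krull dimension of its underlying topological space
(`⊥` if it is empty). -/
def projDim {m : ℕ} (J : Ideal (MvPolynomial (Fin (m + 1)) k)) : WithBot ℕ∞ :=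
  topologicalKrullDim
    (ProjectiveSpectrum.zeroLocus (homogeneousSubmodule (Fin (m + 1)) k)
      (J : Set (MvPolynomial (Fin (m + 1)) k)))

variable {m n : ℕ} (f : Fin (n + 1) → MvPolynomial (Fin (m + 1)) k)

/-- The Jacobian matrix `(∂ f_i / ∂ X_j)`. -/
def jacobianMatrix : Matrix (Fin (n + 1)) (Fin (m + 1)) (MvPolynomial (Fin (m + 1)) k) :=
  Matrix.of fun i j => pderiv j (f i)

/-- The homogeneous ideal of the closed image of the rational map `ℙ^m ⇢ ℙ^n` defined by `f`: the
kernel of `k[T_0, …, T_n] → k[X_0, …, X_m]`, `T_i ↦ f_i`. -/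
def closedImageIdeal : Ideal (MvPolynomial (Fin (n + 1)) k) :=
  RingHom.ker (aeval f : MvPolynomial (Fin (n + 1)) k →ₐ[k] MvPolynomial (Fin (m + 1)) k)

/-- The rational map defined by `f` is generically finite onto its image, that is, its closed image
has dimension `m`. -/
def IsGenericallyFinite : Prop :=
  projDim (closedImageIdeal f) = (m : WithBot ℕ∞)

/-- With `R = k[X_0, …, X_m]` and `I = (f_0, …, f_n)`, the surjection of `R[T_0, …, T_n]` onto the
Rees algebra `⨁ I^s t^s ⊆ R[t]`, sending `T_i` to `f_i t`. -/
def reesMap : MvPolynomial (Fin (n + 1)) (MvPolynomial (Fin (m + 1)) k) →ₐ[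
    MvPolynomial (Fin (m + 1)) k] Polynomial (MvPolynomial (Fin (m + 1)) k) :=
  aeval fun i => Polynomial.C (f i) * Polynomial.X

/-- The ideal defining the Rees algebra, hence the blow-up `Γ ⊆ ℙ^m × ℙ^n`, which is the closure of
the graph of the rational map. -/
def reesIdeal : Ideal (MvPolynomial (Fin (n + 1)) (MvPolynomial (Fin (m + 1)) k)) :=
  RingHom.ker (reesMap f)

/-- Specialization of the variables `T_i` at the coordinates of `p`. -/
def specialize (p : Fin (n + 1) → k) :
    MvPolynomial (Fin (n + 1)) (MvPolynomial (Fin (m + 1)) k) →+* MvPolynomial (Fin (m + 1)) k :=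
  eval fun i => C (p i)

/-- The ideal of `R = k[X_0, …, X_m]` defining the fiber of the projection `π : Γ → ℙ^n` over the
point with homogeneous coordinates `p`: the Rees algebra tensored over `k[T_0, …, T_n]` with the
residue field `k` is `R` modulo this ideal, so the fiber is `Proj` of that quotient in `ℙ^m`. -/
def fiberIdeal (p : Fin (n + 1) → k) : Ideal (MvPolynomial (Fin (m + 1)) k) :=
  (reesIdeal f).map (specialize p)

/-- The fiber ideal does not depend on the choice of homogeneous coordinates. -/
theorem fiberIdeal_smul (p : Fin (n + 1) → k) {c : k} (hc : c ≠ 0) :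
    fiberIdeal f (c • p) = fiberIdeal f p := by
  have key : ∀ (p : Fin (n + 1) → k) (c : k), fiberIdeal f (c • p) ≤ fiberIdeal f p := by
    intro p c
    refine Ideal.map_le_iff_le_comap.2 fun P hP => ?_
    have hP' : reesMap f P = 0 := hP
    let σ : MvPolynomial (Fin (n + 1)) (MvPolynomial (Fin (m + 1)) k) →ₐ[
        MvPolynomial (Fin (m + 1)) k] MvPolynomial (Fin (n + 1)) (MvPolynomial (Fin (m + 1)) k) :=
      aeval fun i => C (C c) * X i
    let τ : Polynomial (MvPolynomial (Fin (m + 1)) k) →ₐ[MvPolynomial (Fin (m + 1)) k]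
        Polynomial (MvPolynomial (Fin (m + 1)) k) :=
      Polynomial.aeval (Polynomial.C (C c) * Polynomial.X)
    have h1 : (reesMap f).comp σ = τ.comp (reesMap f) := by
      ext i : 1
      simp [σ, τ, reesMap]
      ring
    have h2 : (specialize p).comp σ.toRingHom = specialize (m := m) (c • p) := by
      refine MvPolynomial.ringHom_ext (fun a => ?_) (fun i => ?_) <;> simp [σ, specialize]
    have h3 : σ P ∈ reesIdeal f := by
      have := DFunLike.congr_fun h1 P
      simp only [AlgHom.comp_apply, hP', map_zero] at this
      exact this
    have h4 := Ideal.mem_map_of_mem (specialize p) h3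
    have h5 : specialize p (σ P) = specialize (c • p) P := DFunLike.congr_fun h2 P
    rw [h5] at h4
    exact h4
  refine le_antisymm (key p c) ?_
  have := key (c • p) c⁻¹
  rwa [smul_smul, inv_mul_cancel₀ hc, one_smul] at this

/-- The ideal of the fiber over a closed point `y` of `ℙ^n`. -/
def fiberIdealAt (y : Projectivization k (Fin (n + 1) → k)) :
    Ideal (MvPolynomial (Fin (m + 1)) k) :=
  fiberIdeal f y.rep

/-- The set of closed points of `ℙ^n` whose fiber has dimension `l`. -/
def fiberDimLocus (l : ℕ) : Set (Projectivization k (Fin (n + 1) → k)) :=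
  {y | projDim (fiberIdealAt f y) = (l : WithBot ℕ∞)}

end

/-!
The minors `p_i f_j - p_j f_i` lie in the ideal of the fiber over `p`. If `g` divides all of them
and `p ≠ 0`, then `f_j = p_j u + g v_j`, where `u` is prime to `g` because `gcd(f) = 1`. A form `P`
of degree `s` in the `T_j` with `P(f) = 0` then satisfies `u ^ s P(p) ≡ 0` modulo `g`, so `g`
divides `P(p)`: the gcd of these minors is the gcd of the whole fiber ideal, and it generates the
unmixed part when the fiber has codimension one.

If `q ^ e` divides all these minors, differentiating `f_j = p_j u + q ^ e v_j` shows that, up to a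
multiple of `q ^ e`, the Jacobian matrix is a matrix of rank one plus `q ^ (e - 1)` times another
matrix of rank one, so `q ^ (2 e - 1)` divides its `3 × 3` minors, hence `F`. Finally, at two
distinct points such divisors `g` are relatively prime, so the product over all points of the
`q ^ (2 e - 1)` divides `F`.
-/

section GCD

variable {R : Type*} [CommRing R]

theorem exists_isGCDOf_range [UniqueFactorizationMonoid R] {ι : Type*} [Finite ι]
    (a : ι → R) : ∃ g, IsGCDOf (Set.range a) g := by
  classical
  have := Fintype.ofFinite ι
  let _ := UniqueFactorizationMonoid.strongNormalizationMonoid (α := R)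
  let _ := UniqueFactorizationMonoid.toNormalizedGCDMonoid R
  refine ⟨Finset.univ.gcd a, ?_, fun c hc => Finset.dvd_gcd fun i _ => hc _ ⟨i, rfl⟩⟩
  rintro _ ⟨i, rfl⟩
  exact Finset.gcd_dvd (Finset.mem_univ i)

theorem IsGCDOf.ne_zero {S : Set R} {g s : R} (hg : IsGCDOf S g) (hs : s ∈ S) (h0 : s ≠ 0) :
    g ≠ 0 :=
  ne_zero_of_dvd_ne_zero h0 (hg.1 s hs)

end GCD

section Determinant

open Matrix

variable {R s t : Type*} [CommRing R] [Fintype s] [DecidableEq s] [Fintype t] [DecidableEq t]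

-- For invertible `D` this is the Schur complement formula, with `X = c • D⁻¹`.
theorem pow_mul_det_smul_add_mul_mul (V : Matrix s s R) (K : Matrix s t R) (L : Matrix t s R)
    {D X : Matrix t t R} {c : R} (h : D * X = c • 1) :
    c ^ Fintype.card t * (c • V + K * D * L).det =
      c ^ Fintype.card s * D.det * (fromBlocks X (-L) K V).det := by
  have hfactor : fromBlocks 1 (-(D * L)) K (c • V) * fromBlocks (c • 1) 0 0 1 =
      fromBlocks D 0 0 (c • 1) * fromBlocks X (-L) K V := by
    simp [fromBlocks_multiply, h]
  have hdet := congrArg det hfactor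
  simp only [det_mul, det_fromBlocks_one₁₁, det_fromBlocks_zero₁₂, det_smul, det_one, mul_one,
    Matrix.mul_neg, sub_neg_eq_add, ← Matrix.mul_assoc] at hdet
  rw [mul_comm, hdet]
  ring

theorem pow_dvd_det_smul_add_vecMulVec_add [IsDomain R] {q : R} (hq : q ≠ 0) {e : ℕ} (he : 0 < e)
    (V : Matrix s s R) (a b u w : s → R) :
    q ^ ((Fintype.card s - 1) * e - 1) ∣
      (q ^ e • V + vecMulVec a u + q ^ (e - 1) • vecMulVec b w).det := by
  rcases Nat.lt_or_ge (Fintype.card s) 2 with hs | hs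
  · simp [show Fintype.card s - 1 = 0 by lia]
  let D : Matrix (Fin 2) (Fin 2) R := diagonal ![1, q ^ (e - 1)]
  let K : Matrix s (Fin 2) R := of fun i => ![a i, b i]
  let L : Matrix (Fin 2) s R := of ![u, w]
  have hKDL : vecMulVec a u + q ^ (e - 1) • vecMulVec b w = K * D * L := by
    ext i j
    simp [K, D, L, mul_apply, vecMulVec_apply]
    ring
  have hD : D * diagonal ![q ^ e, q] = q ^ e • 1 := by
    rw [diagonal_mul_diagonal, smul_one_eq_diagonal, diagonal_eq_diagonal_iff]
    simp [Fin.forall_fin_two, ← pow_succ, Nat.sub_add_cancel he]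
  have hexp : e * Fintype.card s + (e - 1) = e * 2 + ((Fintype.card s - 1) * e - 1) := by
    obtain ⟨r, hr⟩ := Nat.exists_eq_add_of_le hs
    have : 0 < (r + 1) * e := by positivity
    rw [hr, show 2 + r - 1 = r + 1 by lia]
    grind
  have hdet := pow_mul_det_smul_add_mul_mul V K L hD
  rw [← hKDL, ← add_assoc, show D.det = q ^ (e - 1) by simp [D], Fintype.card_fin, ← pow_mul,
    ← pow_mul, ← pow_add, hexp, pow_add, mul_assoc] at hdet
  exact Dvd.intro _ (mul_left_cancel₀ (pow_ne_zero _ hq) hdet).symm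

end Determinant

section Homogeneous

theorem isHomogeneous_det {σ R ι : Type*} [CommRing R] [Fintype ι] [DecidableEq ι] {d : ℕ}
    {M : Matrix ι ι (MvPolynomial σ R)} (hM : ∀ i j, (M i j).IsHomogeneous d) :
    M.det.IsHomogeneous (Fintype.card ι * d) := by
  rw [Matrix.det_apply]
  refine IsHomogeneous.sum _ _ _ fun τ _ => ?_
  have hprod : (∏ i, M (τ i) i).IsHomogeneous (Fintype.card ι * d) := by
    simpa using IsHomogeneous.prod Finset.univ (fun i => M (τ i) i) (fun _ => d) fun i _ => hM _ _
  rw [Units.smul_def, ← Int.cast_smul_eq_zsmul R]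
  exact (homogeneousSubmodule σ R _).smul_mem _ hprod

variable {σ R : Type*} [CommRing R]

theorem order_le_totalDegree {a : MvPolynomial σ R} (ha : a ≠ 0) :
    (a : MvPowerSeries σ R).order ≤ a.totalDegree := by
  obtain ⟨d, hd⟩ := ne_zero_iff.1 ha
  exact (MvPowerSeries.order_le (by simpa using hd)).trans
    (Nat.cast_le.2 (le_totalDegree (mem_support_iff.2 hd)))

theorem isHomogeneous_totalDegree_iff_le_order {a : MvPolynomial σ R} :
    a.IsHomogeneous a.totalDegree ↔ (a.totalDegree : ℕ∞) ≤ (a : MvPowerSeries σ R).order := by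
  refine ⟨fun h => MvPowerSeries.le_order fun d hd => ?_, fun h d hd => ?_⟩
  · exact h.coeff_eq_zero (Nat.cast_lt.1 hd).ne
  · have hdeg : d.degree = a.totalDegree := le_antisymm (le_totalDegree (mem_support_iff.2 hd))
      (Nat.cast_le.1 (h.trans (MvPowerSeries.order_le (by simpa using hd))))
    rwa [Finsupp.degree_eq_weight_one] at hdeg

theorem isHomogeneous_totalDegree_of_dvd [IsDomain R] {a b : MvPolynomial σ R} {N : ℕ}
    (hb : b.IsHomogeneous N) (hb0 : b ≠ 0) (h : a ∣ b) : a.IsHomogeneous a.totalDegree := by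
  obtain ⟨c, rfl⟩ := h
  have ha := left_ne_zero_of_mul hb0
  have hc := right_ne_zero_of_mul hb0
  rw [← hb.totalDegree hb0, isHomogeneous_totalDegree_iff_le_order,
    totalDegree_mul_of_isDomain ha hc, coe_mul, MvPowerSeries.order_mul, Nat.cast_add] at hb
  rw [isHomogeneous_totalDegree_iff_le_order]
  exact (ENat.add_le_add_iff_right (ENat.natCast_ne_top _)).1
    (hb.trans (by gcongr; exact order_le_totalDegree hc))

end Homogeneous

section Degree

variable {σ R : Type*} [CommRing R] [IsDomain R]

theorem totalDegree_prod_of_ne_zero {ι : Type*} (s : Finset ι) (g : ι → MvPolynomial σ R)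
    (h : ∀ i ∈ s, g i ≠ 0) :
    (∏ i ∈ s, g i).totalDegree = ∑ i ∈ s, (g i).totalDegree := by
  induction s using Finset.cons_induction with
  | empty => simp
  | cons a s ha ih =>
    rw [Finset.forall_mem_cons] at h
    rw [Finset.prod_cons, Finset.sum_cons, totalDegree_mul_of_isDomain h.1
      (Finset.prod_ne_zero_iff.2 h.2), ih h.2]

theorem totalDegree_pow_of_ne_zero {a : MvPolynomial σ R} (ha : a ≠ 0) (N : ℕ) :
    (a ^ N).totalDegree = N * a.totalDegree := by
  simpa using totalDegree_prod_of_ne_zero (Finset.range N) (fun _ => a) fun _ _ => ha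

theorem sum_totalDegree_le_of_dvd_of_isRelPrime [UniqueFactorizationMonoid R] {ι : Type*}
    {F : MvPolynomial σ R} (hF : F ≠ 0) {T : Finset ι} {B : ι → MvPolynomial σ R}
    (hdvd : ∀ i ∈ T, B i ∣ F) (hrel : (T : Set ι).Pairwise fun i j => IsRelPrime (B i) (B j)) :
    ∑ i ∈ T, (B i).totalDegree ≤ F.totalDegree := by
  rw [← totalDegree_prod_of_ne_zero T B fun i hi => ne_zero_of_dvd_ne_zero hF (hdvd i hi)]
  exact totalDegree_le_of_dvd_of_isDomain (Finset.prod_dvd_of_isRelPrime hrel hdvd) hF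

theorem totalDegree_pos_of_not_isUnit {k : Type*} [Field k] {a : MvPolynomial σ k} (ha : a ≠ 0)
    (hu : ¬ IsUnit a) : 0 < a.totalDegree := by
  refine Nat.pos_of_ne_zero fun hdeg => hu (isUnit_iff_totalDegree_of_isReduced.2 ⟨?_, hdeg⟩)
  rw [totalDegree_eq_zero_iff_eq_C.1 hdeg] at ha
  exact isUnit_iff_ne_zero.2 fun h0 => ha (by rw [h0, C_0])

end Degree

section Dimension

open TopologicalSpace

theorem topologicalKrullDim_add_one_le_of_isInducing {X Y : Type*} [TopologicalSpace X]
    [TopologicalSpace Y] [Nonempty X] {φ : X → Y} (hφ : Topology.IsInducing φ) {y : Y}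
    (hy : ∀ x, φ x ⤳ y) (hy' : ∀ x, ¬ y ⤳ φ x) :
    topologicalKrullDim X + 1 ≤ topologicalKrullDim Y := by
  let ψ : WithBot (IrreducibleCloseds X) → IrreducibleCloseds Y :=
    WithBot.recBotCoe ⟨closure {y}, isIrreducible_singleton.closure, isClosed_closure⟩
      (IrreducibleCloseds.map φ hφ.continuous)
  have hψ : StrictMono ψ := by
    refine WithBot.strictMono_iff.2
      ⟨IrreducibleCloseds.map_strictMono_of_isInducing hφ, fun W => ?_⟩
    obtain ⟨x, hx⟩ := W.isIrreducible.nonempty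
    have hxW : φ x ∈ closure (φ '' W) := subset_closure ⟨x, hx, rfl⟩
    refine lt_of_le_not_ge (closure_minimal (Set.singleton_subset_iff.2
      ((hy x).mem_closed isClosed_closure hxW)) isClosed_closure) fun hle => ?_
    exact hy' x (specializes_iff_mem_closure.2 (hle hxW))
  have : Nonempty (IrreducibleCloseds X) :=
    ⟨⟨closure {Classical.arbitrary X}, isIrreducible_singleton.closure, isClosed_closure⟩⟩
  exact Order.krullDim_withBot.symm.trans_le (Order.krullDim_le_of_strictMono ψ hψ)

theorem topologicalKrullDim_zeroLocus_eq_ringKrullDim_quotient {R : Type*} [CommRing R]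
    (J : Ideal R) :
    topologicalKrullDim (PrimeSpectrum.zeroLocus (J : Set R)) = ringKrullDim (R ⧸ J) := by
  rw [ringKrullDim_quotient, Order.krullDim_eq_of_orderIso
    (PrimeSpectrum.zeroLocusEquivIrreducibleCloseds (J : Set R)), Order.krullDim_orderDual]
  rfl

theorem exists_ringKrullDim_quotient_prime_eq {R : Type*} [CommRing R] {J : Ideal R} {d : ℕ}
    (hd : ringKrullDim (R ⧸ J) = d) :
    ∃ P : Ideal R, P.IsPrime ∧ J ≤ P ∧ ringKrullDim (R ⧸ P) = d := by
  obtain ⟨c, hc⟩ := Order.le_krullDim_iff.1 ((ringKrullDim_quotient J).symm.trans hd).ge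
  have hJ : J ≤ c.head.1.asIdeal := c.head.2
  refine ⟨c.head.1.asIdeal, c.head.1.isPrime, hJ, le_antisymm ?_ ?_⟩
  · exact hd ▸ ringKrullDim_le_of_surjective _ (Ideal.Quotient.factor_surjective hJ)
  · rw [ringKrullDim_quotient]
    exact Order.le_krullDim_iff.2 ⟨⟨c.length, fun i => ⟨(c i).1, c.monotone (Fin.zero_le i)⟩,
      fun i => c.step i⟩, hc⟩

theorem eq_of_le_of_ringKrullDim_quotient_eq {R : Type*} [CommRing R] {P Q : Ideal R} [P.IsPrime]
    (hPQ : P ≤ Q) {d : ℕ} (hP : ringKrullDim (R ⧸ P) = d) (hQ : ringKrullDim (R ⧸ Q) = d) :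
    P = Q := by
  by_contra hne
  obtain ⟨r, hrQ, hrP⟩ := SetLike.exists_of_lt (lt_of_le_of_ne hPQ hne)
  have hlt := ringKrullDim_succ_le_of_surjective (Ideal.Quotient.factor hPQ)
    (Ideal.Quotient.factor_surjective hPQ) (r := Ideal.Quotient.mk P r)
    (mem_nonZeroDivisors_of_ne_zero (by rwa [Ne, Ideal.Quotient.eq_zero_iff_mem]))
    (by rwa [Ideal.Quotient.factor_mk, Ideal.Quotient.eq_zero_iff_mem])
  rw [hP, hQ] at hlt
  exact Nat.not_succ_le_self d (by exact_mod_cast hlt)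

variable {k : Type*} [Field k] {m : ℕ}

theorem ringKrullDim_mvPolynomial_fin : ringKrullDim (MvPolynomial (Fin m) k) = m := by
  simp [MvPolynomial.ringKrullDim_of_isNoetherianRing]

theorem height_eq_of_isMaximal (M : Ideal (MvPolynomial (Fin m) k)) [hM : M.IsMaximal] :
    M.height = m := by
  induction m with
  | zero =>
    have hle := Ideal.height_le_ringKrullDim_of_ne_top hM.ne_top
    rw [ringKrullDim_mvPolynomial_fin] at hle
    simpa using hle
  | succ m ih =>
    let e := (finSuccEquiv k m).toRingEquiv
    let P := M.comap e.symm
    have hP : P.IsMaximal := Ideal.comap_isMaximal_of_equiv e.symm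
    have hp : (P.comap Polynomial.C).IsMaximal := Polynomial.isMaximal_comap_C_of_isJacobsonRing P
    have : P.LiesOver (P.comap Polynomial.C) := ⟨rfl⟩
    rw [← RingEquiv.height_comap e.symm M,
      Polynomial.height_eq_height_add_one (P.comap Polynomial.C) P, ih]
    rfl

theorem ringKrullDim_quotient_span_singleton {q : MvPolynomial (Fin (m + 1)) k} (hq0 : q ≠ 0)
    (hq : ¬ IsUnit q) : ringKrullDim (MvPolynomial (Fin (m + 1)) k ⧸ Ideal.span {q}) = m := by
  refine le_antisymm ?_ ?_ <;> refine ENat.WithBot.add_le_add_one_right_iff.1 ?_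
  · have := ringKrullDim_quotient_succ_le_of_nonZeroDivisor (mem_nonZeroDivisors_of_ne_zero hq0)
    rw [ringKrullDim_mvPolynomial_fin] at this
    exact_mod_cast this
  · obtain ⟨M, hM, hqM⟩ := exists_max_ideal_of_mem_nonunits hq
    have := Ideal.height_le_ringKrullDim_quotient_add_one hqM
    rw [height_eq_of_isMaximal] at this
    exact_mod_cast this

theorem isInducing_projectiveSpectrum_toPrimeSpectrum {A S : Type*} [CommRing A] [SetLike S A]
    [AddSubgroupClass S A] (𝒜 : ℕ → S) [GradedRing 𝒜] :
    Topology.IsInducing fun x : ProjectiveSpectrum 𝒜 =>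
      (⟨x.asHomogeneousIdeal.toIdeal, x.isPrime⟩ : PrimeSpectrum A) := by
  refine ⟨TopologicalSpace.ext_iff_isClosed.2 fun Z => ?_⟩
  simp only [isClosed_induced_iff, PrimeSpectrum.isClosed_iff_zeroLocus,
    ProjectiveSpectrum.isClosed_iff_zeroLocus]
  constructor
  · rintro ⟨s, rfl⟩
    exact ⟨_, ⟨s, rfl⟩, rfl⟩
  · rintro ⟨_, ⟨s, rfl⟩, rfl⟩
    exact ⟨s, rfl⟩

attribute [local instance] MvPolynomial.gradedAlgebra

theorem le_ker_constantCoeff_of_ne_top {σ : Type*} {I : HomogeneousIdeal (homogeneousSubmodule σ k)}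
    (hI : I.toIdeal ≠ ⊤) : I.toIdeal ≤ RingHom.ker constantCoeff := by
  intro a ha
  have hC : C (constantCoeff a) ∈ I.toIdeal := by
    simpa [constantCoeff_eq] using (mem_iff_homogeneousComponent_mem I.isHomogeneous a).1 ha 0
  by_contra h
  exact hI (Ideal.eq_top_of_isUnit_mem _ hC ((isUnit_iff_ne_zero.2 h).map C))

theorem irrelevant_le_ker_constantCoeff {σ : Type*} :
    (HomogeneousIdeal.irrelevant (homogeneousSubmodule σ k)).toIdeal ≤
      RingHom.ker constantCoeff := by
  rw [HomogeneousIdeal.toIdeal_irrelevant_le]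
  exact fun i hi a ha => IsHomogeneous.coeff_eq_zero ha (by simpa using hi.ne)

theorem projDim_add_one_le_ringKrullDim_quotient (J : Ideal (MvPolynomial (Fin (m + 1)) k)) :
    projDim J + 1 ≤ ringKrullDim (MvPolynomial (Fin (m + 1)) k ⧸ J) := by
  rw [← topologicalKrullDim_zeroLocus_eq_ringKrullDim_quotient]
  set Z := ProjectiveSpectrum.zeroLocus (homogeneousSubmodule (Fin (m + 1)) k)
    (J : Set (MvPolynomial (Fin (m + 1)) k))
  rcases isEmpty_or_nonempty Z with hZ | hZ
  · have : IsEmpty (IrreducibleCloseds Z) := ⟨fun W => hZ.elim W.isIrreducible.nonempty.some⟩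
    have hbot : projDim J = ⊥ := Order.krullDim_eq_bot
    simp [hbot]
  have hle (x : Z) : x.1.asHomogeneousIdeal.toIdeal ≤ RingHom.ker constantCoeff :=
    le_ker_constantCoeff_of_ne_top x.1.isPrime.ne_top
  have hprime : (RingHom.ker (constantCoeff (R := k) (σ := Fin (m + 1)))).IsPrime :=
    RingHom.ker_isPrime _
  -- The additional point is the vertex of the affine cone, which lies in every homogeneous prime.
  refine topologicalKrullDim_add_one_le_of_isInducing
    (φ := fun x : Z => ⟨⟨x.1.asHomogeneousIdeal.toIdeal, x.1.isPrime⟩, x.2⟩)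
    (y := ⟨⟨RingHom.ker constantCoeff, hprime⟩, (Classical.arbitrary Z).2.trans (hle _)⟩)
    ?_ (fun x => ?_) (fun x => ?_)
  · exact ((isInducing_projectiveSpectrum_toPrimeSpectrum _).comp
      Topology.IsInducing.subtypeVal).codRestrict fun x => x.2
  · rw [subtype_specializes_iff, ← PrimeSpectrum.le_iff_specializes]
    exact hle x
  · rw [subtype_specializes_iff, ← PrimeSpectrum.le_iff_specializes]
    exact fun h => x.1.not_irrelevant_le (irrelevant_le_ker_constantCoeff.trans h)

theorem ringKrullDim_quotient_eq_of_projDim (hm : 0 < m)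
    {J : Ideal (MvPolynomial (Fin (m + 1)) k)} (hJ0 : J ≠ ⊥) (hJ : projDim J = (m - 1 : ℕ)) :
    ringKrullDim (MvPolynomial (Fin (m + 1)) k ⧸ J) = m := by
  refine le_antisymm (ENat.WithBot.add_le_add_one_right_iff.1 ?_) ?_
  · obtain ⟨a, haJ, ha0⟩ := Submodule.exists_mem_ne_zero_of_ne_bot hJ0
    have hquot := ringKrullDim_le_of_surjective _
      (Ideal.Quotient.factor_surjective ((Ideal.span_singleton_le_iff_mem _).2 haJ))
    have hspan := ringKrullDim_quotient_succ_le_of_nonZeroDivisor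
      (mem_nonZeroDivisors_of_ne_zero ha0)
    rw [ringKrullDim_mvPolynomial_fin] at hspan
    exact_mod_cast (add_le_add_left hquot 1).trans hspan
  · have hproj := projDim_add_one_le_ringKrullDim_quotient J
    rw [hJ] at hproj
    rwa [← Nat.cast_succ, Nat.succ_eq_add_one, Nat.sub_add_cancel hm] at hproj

end Dimension

section UnmixedPart

theorem le_unmixedPart {R : Type*} [CommRing R] (J : Ideal R) : J ≤ unmixedPart J :=
  le_iInf fun _ => Ideal.le_comap_map

theorem mem_unmixedPart_iff {R : Type*} [CommRing R] {J : Ideal R} {x : R} :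
    x ∈ unmixedPart J ↔ ∀ P : Ideal R, P.IsPrime → J ≤ P →
      ringKrullDim (R ⧸ P) = ringKrullDim (R ⧸ J) → ∃ s ∉ P, s * x ∈ J := by
  simp only [unmixedPart, Ideal.mem_iInf, Ideal.mem_comap, Subtype.forall]
  refine ⟨fun h P hP hJP hdim => ?_, fun h P hP => ?_⟩
  · exact (IsLocalization.algebraMap_mem_map_algebraMap_iff P.primeCompl _ _ _).1
      (h ⟨P, hP⟩ ⟨hJP, hdim⟩)
  · exact (IsLocalization.algebraMap_mem_map_algebraMap_iff P.asIdeal.primeCompl _ _ _).2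
      (h P.asIdeal P.isPrime hP.1 hP.2)

variable {R : Type*} [CommRing R] [UniqueFactorizationMonoid R] {J : Ideal R} {g : R} {d : ℕ}

theorem exists_prime_eq_span_of_ringKrullDim_quotient
    (hR : ∀ q : R, Prime q → ringKrullDim (R ⧸ Ideal.span {q}) = d)
    {P : Ideal R} [hP : P.IsPrime] (hP0 : P ≠ ⊥) (hd : ringKrullDim (R ⧸ P) = d) :
    ∃ q, Prime q ∧ P = Ideal.span {q} := by
  obtain ⟨q, hqP, hq⟩ := hP.exists_mem_prime_of_ne_bot hP0
  have : (Ideal.span {q}).IsPrime := (Ideal.span_singleton_prime hq.ne_zero).2 hq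
  exact ⟨q, hq, (eq_of_le_of_ringKrullDim_quotient_eq
    ((Ideal.span_singleton_le_iff_mem _).2 hqP) (hR q hq) hd).symm⟩

theorem not_isUnit_of_isGCDOf_of_ringKrullDim_quotient
    (hR : ∀ q : R, Prime q → ringKrullDim (R ⧸ Ideal.span {q}) = d) (hJ0 : J ≠ ⊥)
    (hd : ringKrullDim (R ⧸ J) = d) (hg : IsGCDOf (J : Set R) g) : ¬ IsUnit g := by
  obtain ⟨P, hP, hJP, hPd⟩ := exists_ringKrullDim_quotient_prime_eq hd
  obtain ⟨q, hq, rfl⟩ := exists_prime_eq_span_of_ringKrullDim_quotient hR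
    (ne_bot_of_le_ne_bot hJ0 hJP) hPd
  exact fun hu => hq.not_isUnit
    (isUnit_of_dvd_unit (hg.2 q fun a ha => Ideal.mem_span_singleton.1 (hJP ha)) hu)

variable [IsDomain R]

theorem unmixedPart_le_span_of_le_span
    (hR : ∀ q : R, Prime q → ringKrullDim (R ⧸ Ideal.span {q}) = ringKrullDim (R ⧸ J))
    (hg0 : g ≠ 0) (hJ : J ≤ Ideal.span {g}) : unmixedPart J ≤ Ideal.span {g} := by
  intro x hx
  rw [Ideal.mem_span_singleton]
  obtain ⟨g', x', c, hrel, rfl, rfl⟩ := UniqueFactorizationMonoid.exists_reduced_factors g hg0 x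
  have hc : c ≠ 0 := left_ne_zero_of_mul hg0
  by_contra hnd
  have hg'unit : ¬ IsUnit g' := fun hu => hnd (mul_dvd_mul_left c hu.dvd)
  obtain ⟨q, hq, hqg'⟩ := WfDvdMonoid.exists_irreducible_factor hg'unit (right_ne_zero_of_mul hg0)
  obtain ⟨s, hs, hsx⟩ := mem_unmixedPart_iff.1 hx (Ideal.span {q})
    ((Ideal.span_singleton_prime hq.ne_zero).2 hq.prime)
    (hJ.trans (Ideal.span_singleton_le_span_singleton.2 (hqg'.mul_left c))) (hR q hq.prime)
  have hdvd : c * g' ∣ c * (s * x') := by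
    rw [← Ideal.mem_span_singleton, mul_left_comm]
    exact hJ hsx
  have hg's : g' ∣ s := hrel.dvd_of_dvd_mul_right ((mul_dvd_mul_iff_left hc).1 hdvd)
  exact hs (Ideal.mem_span_singleton.2 (hqg'.trans hg's))

theorem unmixedPart_eq_span_of_isGCDOf
    (hR : ∀ q : R, Prime q → ringKrullDim (R ⧸ Ideal.span {q}) = d) (hJ0 : J ≠ ⊥)
    (hd : ringKrullDim (R ⧸ J) = d) (hg : IsGCDOf (J : Set R) g) :
    unmixedPart J = Ideal.span {g} := by
  obtain ⟨b, hb, hb0⟩ := Submodule.exists_mem_ne_zero_of_ne_bot hJ0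
  have hg0 : g ≠ 0 := hg.ne_zero hb hb0
  refine le_antisymm (unmixedPart_le_span_of_le_span (fun q hq => (hR q hq).trans hd.symm) hg0
    fun a ha => Ideal.mem_span_singleton.2 (hg.1 a ha)) ?_
  rw [Ideal.span_singleton_le_iff_mem, mem_unmixedPart_iff]
  intro P hP hJP hdim
  obtain ⟨q, hq, rfl⟩ := exists_prime_eq_span_of_ringKrullDim_quotient hR
    (ne_bot_of_le_ne_bot hJ0 hJP) (hdim.trans hd)
  obtain ⟨a, ha, hga⟩ : ∃ a ∈ J, ¬ g * q ∣ a := by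
    by_contra! hall
    have hgq : g * q ∣ g * 1 := by simpa using hg.2 _ hall
    exact hq.not_isUnit (isUnit_of_dvd_one ((mul_dvd_mul_iff_left hg0).1 hgq))
  obtain ⟨s, rfl⟩ := hg.1 a ha
  refine ⟨s, fun hs => hga (mul_dvd_mul_left g (Ideal.mem_span_singleton.1 hs)), ?_⟩
  rwa [mul_comm]

end UnmixedPart

section Evaluation

variable {σ R : Type*} [CommRing R]

theorem dvd_eval_sub_eval {a b : σ → R} {g : R} (h : ∀ i, g ∣ a i - b i) (P : MvPolynomial σ R) :
    g ∣ eval a P - eval b P := by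
  have heval : (Ideal.Quotient.mk (Ideal.span {g})).comp (eval a) =
      (Ideal.Quotient.mk (Ideal.span {g})).comp (eval b) := by
    refine ringHom_ext (fun r => by simp) fun i => ?_
    simpa [Ideal.Quotient.mk_eq_mk_iff_sub_mem, Ideal.mem_span_singleton] using h i
  rw [← Ideal.mem_span_singleton, ← Ideal.Quotient.mk_eq_mk_iff_sub_mem]
  exact DFunLike.congr_fun heval P

theorem eval_mul_const_of_isHomogeneous {P : MvPolynomial σ R} {s : ℕ} (hP : P.IsHomogeneous s)
    (a : σ → R) (u : R) : eval (fun i => a i * u) P = eval a P * u ^ s := by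
  simp only [eval_eq, Finset.sum_mul]
  refine Finset.sum_congr rfl fun c hc => ?_
  have hdeg : ∑ i ∈ c.support, c i = s := by
    rw [← Finsupp.degree_apply, Finsupp.degree_eq_weight_one]
    exact hP (mem_support_iff.1 hc)
  simp only [mul_pow, Finset.prod_mul_distrib, Finset.prod_pow_eq_pow_sum, hdeg, mul_assoc]

end Evaluation

section Fiber

variable {k : Type*} [Field k] {m n : ℕ} {f : Fin (n + 1) → MvPolynomial (Fin (m + 1)) k}

theorem coeff_reesMap (P : MvPolynomial (Fin (n + 1)) (MvPolynomial (Fin (m + 1)) k)) (s : ℕ) :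
    (reesMap f P).coeff s = eval f (homogeneousComponent s P) := by
  induction P using MvPolynomial.induction_on' with
  | monomial c a =>
    have hmonomial : reesMap f (monomial c a) =
        Polynomial.C (eval f (monomial c a)) * Polynomial.X ^ c.degree := by
      simp only [reesMap, aeval_monomial, eval_monomial, Finsupp.prod, Finsupp.degree_apply,
        mul_pow, Finset.prod_mul_distrib, Finset.prod_pow_eq_pow_sum, map_mul, map_prod, map_pow,
        mul_assoc, Polynomial.algebraMap_eq]
    rw [hmonomial, homogeneousComponent_of_mem (isHomogeneous_monomial a rfl),
      Polynomial.coeff_C_mul_X_pow]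
    split_ifs <;> simp only [map_zero]
  | add P Q hP hQ => simp only [map_add, Polynomial.coeff_add, hP, hQ]

variable (f) in
/-- The `2 × 2` minors `p_i f_j - p_j f_i` of the matrix with rows `p` and `f`, indexed by all pairs
`(i, j)`: they are the equations of the fiber over `p` coming from the Koszul relations. -/
noncomputable def fiberMinor (p : Fin (n + 1) → k) (ij : Fin (n + 1) × Fin (n + 1)) :
    MvPolynomial (Fin (m + 1)) k :=
  C (p ij.1) * f ij.2 - C (p ij.2) * f ij.1

theorem exists_rep_mul_rep_ne {ι : Type*} {y y' : Projectivization k (ι → k)} (hy : y ≠ y') :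
    ∃ i j, y.rep i * y'.rep j ≠ y.rep j * y'.rep i := by
  by_contra! hmul
  obtain ⟨j, hj⟩ := Function.ne_iff.1 y'.rep_nonzero
  refine hy ?_
  rw [← y.mk_rep, ← y'.mk_rep, Projectivization.mk_eq_mk_iff']
  refine ⟨y.rep j / y'.rep j, funext fun i => ?_⟩
  rw [Pi.smul_apply, smul_eq_mul, div_mul_eq_mul_div, div_eq_iff hj]
  exact (hmul i j).symm

variable {p : Fin (n + 1) → k} {g : MvPolynomial (Fin (m + 1)) k}

theorem fiberMinor_mem_fiberIdeal (ij : Fin (n + 1) × Fin (n + 1)) :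
    fiberMinor f p ij ∈ fiberIdeal f p := by
  have hrees : X ij.1 * C (f ij.2) - X ij.2 * C (f ij.1) ∈ reesIdeal f := by
    rw [reesIdeal, RingHom.mem_ker]
    simp only [reesMap, map_sub, map_mul, aeval_X, algHom_C, Polynomial.algebraMap_apply,
      Algebra.algebraMap_self, RingHom.id_apply]
    ring
  simpa [specialize, fiberIdeal, fiberMinor] using Ideal.mem_map_of_mem (specialize p) hrees

theorem exists_eq_C_mul_add_of_dvd_fiberMinor (hp : p ≠ 0) (hg : ∀ ij, g ∣ fiberMinor f p ij) :
    ∃ (u : MvPolynomial (Fin (m + 1)) k) (v : Fin (n + 1) → MvPolynomial (Fin (m + 1)) k),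
      ∀ j, f j = C (p j) * u + g * v j := by
  obtain ⟨i, hi⟩ := Function.ne_iff.1 hp
  choose w hw using fun j => hg (i, j)
  refine ⟨C (p i)⁻¹ * f i, fun j => C (p i)⁻¹ * w j, fun j => ?_⟩
  have hinv : (C (p i)⁻¹ * C (p i) : MvPolynomial (Fin (m + 1)) k) = 1 := by
    rw [← C_mul, inv_mul_cancel₀ hi, C_1]
  have hj : C (p i) * f j - C (p j) * f i = g * w j := hw j
  linear_combination (-f j) * hinv + C (p i)⁻¹ * hj

theorem fiberIdeal_le_span_of_dvd_fiberMinor (hgcd : IsGCDOf (Set.range f) 1) (hp : p ≠ 0)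
    (hg : ∀ ij, g ∣ fiberMinor f p ij) : fiberIdeal f p ≤ Ideal.span {g} := by
  obtain ⟨u, v, hf⟩ := exists_eq_C_mul_add_of_dvd_fiberMinor hp hg
  have hgu : IsRelPrime g u := fun c hcg hcu => isUnit_of_dvd_one <| hgcd.2 c <| by
    rintro _ ⟨j, rfl⟩
    exact hf j ▸ dvd_add (hcu.mul_left _) (hcg.mul_right _)
  refine Ideal.map_le_iff_le_comap.2 fun P hP => ?_
  rw [Ideal.mem_comap, ← sum_homogeneousComponent P, map_sum]
  refine Ideal.sum_mem _ fun s _ => Ideal.mem_span_singleton.2 ?_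
  have hzero : eval f (homogeneousComponent s P) = 0 := by
    rw [← coeff_reesMap, (hP : reesMap f P = 0), Polynomial.coeff_zero]
  have hcongr := dvd_eval_sub_eval (a := fun j => C (p j) * u) (b := f) (g := g)
    (fun j => ⟨-v j, by rw [hf j]; ring⟩) (homogeneousComponent s P)
  rw [hzero, sub_zero,
    eval_mul_const_of_isHomogeneous (homogeneousComponent_isHomogeneous s P)] at hcongr
  exact hgu.pow_right.dvd_of_dvd_mul_right hcongr

theorem isGCDOf_fiberIdeal (hgcd : IsGCDOf (Set.range f) 1) (hp : p ≠ 0)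
    (hg : IsGCDOf (Set.range (fiberMinor f p)) g) : IsGCDOf (fiberIdeal f p : Set _) g := by
  refine ⟨fun a ha => Ideal.mem_span_singleton.1 (fiberIdeal_le_span_of_dvd_fiberMinor hgcd hp
    (fun ij => hg.1 _ ⟨ij, rfl⟩) ha), fun c hc => hg.2 c ?_⟩
  rintro _ ⟨ij, rfl⟩
  exact hc _ (fiberMinor_mem_fiberIdeal ij)

theorem isRelPrime_of_dvd_fiberMinor (hgcd : IsGCDOf (Set.range f) 1)
    {y y' : Projectivization k (Fin (n + 1) → k)} (hy : y ≠ y')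
    {h h' : MvPolynomial (Fin (m + 1)) k} (hh : ∀ ij, h ∣ fiberMinor f y.rep ij)
    (hh' : ∀ ij, h' ∣ fiberMinor f y'.rep ij) : IsRelPrime h h' := by
  intro c hch hch'
  obtain ⟨i, j, hij⟩ := exists_rep_mul_rep_ne hy
  refine isUnit_of_dvd_one (hgcd.2 c ?_)
  rintro _ ⟨l, rfl⟩
  have hminors : C (y.rep i * y'.rep j - y.rep j * y'.rep i) * f l =
      C (y'.rep j) * fiberMinor f y.rep (i, l) + C (y.rep l) * fiberMinor f y'.rep (j, i) +
        C (y'.rep i) * fiberMinor f y.rep (l, j) := by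
    simp only [fiberMinor, C_sub, C_mul]
    ring
  have hunit := (isUnit_iff_ne_zero.2 (sub_ne_zero.2 hij)).map (C (σ := Fin (m + 1)))
  rw [← hunit.dvd_mul_left, hminors]
  exact dvd_add (dvd_add ((hch.trans (hh _)).mul_left _) ((hch'.trans (hh' _)).mul_left _))
    ((hch.trans (hh _)).mul_left _)

end Fiber

section Minors

open Matrix

theorem exists_mem_minorSet_ne_zero {R : Type*} [CommRing R] {a b s : ℕ}
    {M : Matrix (Fin a) (Fin b) R} (hM : minorIdeal s M ≠ ⊥) : ∃ x ∈ minorSet s M, x ≠ 0 := by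
  by_contra! hzero
  exact hM (Ideal.span_eq_bot.2 hzero)

theorem le_of_mem_minorSet {R : Type*} [CommRing R] {a b s : ℕ} {M : Matrix (Fin a) (Fin b) R}
    {x : R} (hx : x ∈ minorSet s M) : s ≤ b := by
  obtain ⟨⟨-, c⟩, -⟩ := hx
  simpa using Fintype.card_le_of_embedding c.toEmbedding

variable {k : Type*} [Field k] {m n : ℕ} {f : Fin (n + 1) → MvPolynomial (Fin (m + 1)) k}
  {s : ℕ} {x : MvPolynomial (Fin (m + 1)) k}

theorem isHomogeneous_of_mem_minorSet_jacobianMatrix {d : ℕ} (hhom : ∀ i, (f i).IsHomogeneous d)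
    (hx : x ∈ minorSet s (jacobianMatrix f)) : x.IsHomogeneous (s * (d - 1)) := by
  obtain ⟨⟨r, c⟩, rfl⟩ := hx
  simpa using isHomogeneous_det (M := (jacobianMatrix f).submatrix r c)
    fun i j => (hhom (r i)).pderiv

theorem jacobianMatrix_eq_of_eq_C_mul_add_pow_mul {p : Fin (n + 1) → k}
    {q u : MvPolynomial (Fin (m + 1)) k} {v : Fin (n + 1) → MvPolynomial (Fin (m + 1)) k} {e : ℕ}
    (hf : ∀ j, f j = C (p j) * u + q ^ e * v j) :
    jacobianMatrix f = q ^ e • jacobianMatrix v +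
      vecMulVec (fun j => C (p j)) (fun i => pderiv i u) +
      q ^ (e - 1) • vecMulVec v (fun i => e * pderiv i q) := by
  ext1 j i
  simp only [jacobianMatrix, of_apply, hf j, map_add, pderiv_C, Derivation.leibniz,
    Derivation.leibniz_pow, Matrix.add_apply, Matrix.smul_apply, vecMulVec_apply, smul_eq_mul,
    nsmul_eq_mul]
  ring

theorem pow_dvd_of_mem_minorSet_jacobianMatrix {p : Fin (n + 1) → k} (hp : p ≠ 0)
    {q : MvPolynomial (Fin (m + 1)) k} (hq : q ≠ 0) {e : ℕ} (he : 0 < e)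
    (hdvd : ∀ ij, q ^ e ∣ fiberMinor f p ij) (hx : x ∈ minorSet s (jacobianMatrix f)) :
    q ^ ((s - 1) * e - 1) ∣ x := by
  obtain ⟨⟨r, c⟩, rfl⟩ := hx
  obtain ⟨u, v, hf⟩ := exists_eq_C_mul_add_of_dvd_fiberMinor hp hdvd
  have := pow_dvd_det_smul_add_vecMulVec_add hq he ((jacobianMatrix v).submatrix r c)
    (fun j => C (p (r j))) (fun j => v (r j)) (fun i => pderiv (c i) u)
    (fun i => e * pderiv (c i) q)
  rw [Fintype.card_fin] at this
  rw [jacobianMatrix_eq_of_eq_C_mul_add_pow_mul hf]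
  exact this

theorem exists_fiberMinor_ne_zero {p : Fin (n + 1) → k} (hp : p ≠ 0) (hs : 2 ≤ s)
    (hx : x ∈ minorSet s (jacobianMatrix f)) (hx0 : x ≠ 0) : ∃ ij, fiberMinor f p ij ≠ 0 := by
  by_contra! hzero
  obtain ⟨⟨r, c⟩, rfl⟩ := hx
  obtain ⟨u, v, hf⟩ := exists_eq_C_mul_add_of_dvd_fiberMinor hp fun ij => zero_dvd_iff.2 (hzero ij)
  have hrank : (jacobianMatrix f).submatrix r c =
      vecMulVec (fun j => C (p (r j))) (fun i => pderiv (c i) u) := by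
    ext1 j i
    simp [jacobianMatrix, hf (r j), vecMulVec_apply]
  have : Nontrivial (Fin s) := Fin.nontrivial_iff_two_le.2 hs
  refine hx0 ?_
  change det _ = 0
  rw [hrank, det_vecMulVec]

end Minors

section Factorization

variable {R : Type*} [CommRing R] {r : ℕ} {h : R} {q : Fin r → R} {e : Fin r → ℕ}

theorem IsIrreducibleFactorization.pow_dvd (hfac : IsIrreducibleFactorization h q e) (i : Fin r) :
    q i ^ e i ∣ h :=
  hfac.eq_prod ▸ Finset.dvd_prod_of_mem (fun i => q i ^ e i) (Finset.mem_univ i)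

theorem IsIrreducibleFactorization.isRelPrime (hfac : IsIrreducibleFactorization h q e)
    {i j : Fin r} (hij : i ≠ j) : IsRelPrime (q i) (q j) :=
  (hfac.irreducible i).isRelPrime_iff_not_dvd.2 fun hdvd => hfac.not_associated i j hij
    ((hfac.irreducible i).associated_of_dvd (hfac.irreducible j) hdvd)

theorem IsIrreducibleFactorization.prod_pow_dvd_pow (hfac : IsIrreducibleFactorization h q e)
    {N : ℕ} {a : Fin r → ℕ} (ha : ∀ i, a i ≤ N * e i) : ∏ i, q i ^ a i ∣ h ^ N := by
  rw [hfac.eq_prod, ← Finset.prod_pow]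
  refine Finset.prod_dvd_prod_of_dvd _ _ fun i _ => ?_
  rw [← pow_mul']
  exact pow_dvd_pow _ (ha i)

theorem IsIrreducibleFactorization.totalDegree_le {σ S : Type*} [CommRing S]
    {h : MvPolynomial σ S} {q : Fin r → MvPolynomial σ S}
    (hfac : IsIrreducibleFactorization h q e) :
    h.totalDegree ≤ ∑ i, (2 * e i - 1) * (q i).totalDegree := by
  rw [hfac.eq_prod]
  refine (totalDegree_finsetProd _ _).trans (Finset.sum_le_sum fun i _ => ?_)
  have := hfac.exponent_pos i
  exact (totalDegree_pow _ _).trans (Nat.mul_le_mul_right _ (by lia))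

end Factorization

section Bound

variable {k : Type*} [Field k] {m n s : ℕ} {f : Fin (n + 1) → MvPolynomial (Fin (m + 1)) k}
  {F : MvPolynomial (Fin (m + 1)) k}

theorem pow_dvd_gcd_minorSet (hF : IsGCDOf (minorSet s (jacobianMatrix f)) F)
    {p : Fin (n + 1) → k} (hp : p ≠ 0) {q : MvPolynomial (Fin (m + 1)) k} (hq : q ≠ 0) {e : ℕ}
    (he : 0 < e) (hdvd : ∀ ij, q ^ e ∣ fiberMinor f p ij) : q ^ ((s - 1) * e - 1) ∣ F :=
  hF.2 _ fun _ hx => pow_dvd_of_mem_minorSet_jacobianMatrix hp hq he hdvd hx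

theorem prod_pow_dvd_gcd_minorSet (hF : IsGCDOf (minorSet s (jacobianMatrix f)) F)
    {p : Fin (n + 1) → k} (hp : p ≠ 0) {h : MvPolynomial (Fin (m + 1)) k}
    (hdvd : ∀ ij, h ∣ fiberMinor f p ij) {r : ℕ} {q : Fin r → MvPolynomial (Fin (m + 1)) k}
    {e : Fin r → ℕ} (hfac : IsIrreducibleFactorization h q e) :
    ∏ i, q i ^ ((s - 1) * e i - 1) ∣ F :=
  Finset.prod_dvd_of_isRelPrime (fun _ _ _ _ hij => (hfac.isRelPrime hij).pow) fun i _ =>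
    pow_dvd_gcd_minorSet hF hp (hfac.irreducible i).ne_zero (hfac.exponent_pos i)
      fun ij => (hfac.pow_dvd i).trans (hdvd ij)

theorem sum_sum_mul_totalDegree_le (hgcd : IsGCDOf (Set.range f) 1)
    (hF : IsGCDOf (minorSet s (jacobianMatrix f)) F) (hF0 : F ≠ 0)
    {T : Finset (Projectivization k (Fin (n + 1) → k))}
    {h : Projectivization k (Fin (n + 1) → k) → MvPolynomial (Fin (m + 1)) k}
    {r : Projectivization k (Fin (n + 1) → k) → ℕ}
    {q : ∀ y, Fin (r y) → MvPolynomial (Fin (m + 1)) k} {e : ∀ y, Fin (r y) → ℕ}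
    (hdvd : ∀ y ∈ T, ∀ ij, h y ∣ fiberMinor f y.rep ij)
    (hfac : ∀ y ∈ T, IsIrreducibleFactorization (h y) (q y) (e y)) :
    ∑ y ∈ T, ∑ i, ((s - 1) * e y i - 1) * (q y i).totalDegree ≤ F.totalDegree := by
  let B (y) : MvPolynomial (Fin (m + 1)) k := ∏ i, q y i ^ ((s - 1) * e y i - 1)
  have hB (y) (hy : y ∈ T) :
      (B y).totalDegree = ∑ i, ((s - 1) * e y i - 1) * (q y i).totalDegree := by
    have hq (i) : q y i ≠ 0 := ((hfac y hy).irreducible i).ne_zero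
    rw [totalDegree_prod_of_ne_zero _ _ fun i _ => pow_ne_zero _ (hq i)]
    exact Finset.sum_congr rfl fun i _ => totalDegree_pow_of_ne_zero (hq i) _
  rw [← Finset.sum_congr rfl hB]
  refine sum_totalDegree_le_of_dvd_of_isRelPrime hF0
    (fun y hy => prod_pow_dvd_gcd_minorSet hF y.rep_nonzero (hdvd y hy) (hfac y hy))
    fun y hy y' hy' hne => ?_
  have hpow (y) (hy : y ∈ T) : B y ∣ h y ^ (s - 1) :=
    (hfac y hy).prod_pow_dvd_pow fun i => Nat.sub_le _ _
  exact ((isRelPrime_of_dvd_fiberMinor hgcd hne (hdvd y hy) (hdvd y' hy')).pow.of_dvd_left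
    (hpow y hy)).of_dvd_right (hpow y' hy')

theorem finite_of_exists_not_isUnit_dvd_fiberMinor (hgcd : IsGCDOf (Set.range f) 1) (hs : 3 ≤ s)
    (hF : IsGCDOf (minorSet s (jacobianMatrix f)) F) (hF0 : F ≠ 0)
    {Y : Set (Projectivization k (Fin (n + 1) → k))}
    (hY : ∀ y ∈ Y, ∃ h ≠ 0, ¬ IsUnit h ∧ ∀ ij, h ∣ fiberMinor f y.rep ij) : Y.Finite := by
  have hirr (y : Y) : ∃ q, Irreducible q ∧ ∀ ij, q ∣ fiberMinor f y.1.rep ij := by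
    obtain ⟨h, h0, hu, hdvd⟩ := hY y y.2
    obtain ⟨q, hq, hqh⟩ := WfDvdMonoid.exists_irreducible_factor hu h0
    exact ⟨q, hq, fun ij => hqh.trans (hdvd ij)⟩
  choose q hq hdvd using hirr
  have hqF (y : Y) : q y ∣ F := (dvd_pow_self _ (by lia)).trans
    (pow_dvd_gcd_minorSet hF y.1.rep_nonzero (hq y).ne_zero one_pos (by simpa using hdvd y))
  by_contra hinf
  have := Set.infinite_coe_iff.2 hinf
  obtain ⟨T, hT⟩ := Infinite.exists_subset_card_eq Y (F.totalDegree + 1)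
  have hsum : ∑ y ∈ T, (q y).totalDegree ≤ F.totalDegree :=
    sum_totalDegree_le_of_dvd_of_isRelPrime hF0 (fun y _ => hqF y) fun y _ y' _ hne =>
      isRelPrime_of_dvd_fiberMinor hgcd (Subtype.coe_ne_coe.2 hne) (hdvd y) (hdvd y')
  have hcard : T.card ≤ ∑ y ∈ T, (q y).totalDegree :=
    T.card_eq_sum_ones.trans_le <| Finset.sum_le_sum fun y _ =>
      totalDegree_pos_of_not_isUnit (hq y).ne_zero (hq y).not_isUnit
  lia

end Bound

section Locus

variable {k : Type*} [Field k] {m n d : ℕ} {f : Fin (n + 1) → MvPolynomial (Fin (m + 1)) k}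

theorem dvd_fiberMinor_of_unmixedPart_eq_span {p : Fin (n + 1) → k}
    {h : MvPolynomial (Fin (m + 1)) k} (hh : unmixedPart (fiberIdeal f p) = Ideal.span {h})
    (ij : Fin (n + 1) × Fin (n + 1)) : h ∣ fiberMinor f p ij := by
  rw [← Ideal.mem_span_singleton, ← hh]
  exact le_unmixedPart _ (fiberMinor_mem_fiberIdeal ij)

theorem isHomogeneous_totalDegree_of_dvd_fiberMinor (hhom : ∀ i, (f i).IsHomogeneous d)
    {p : Fin (n + 1) → k} {ij : Fin (n + 1) × Fin (n + 1)} (h0 : fiberMinor f p ij ≠ 0)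
    {h : MvPolynomial (Fin (m + 1)) k} (hdvd : h ∣ fiberMinor f p ij) :
    h.IsHomogeneous h.totalDegree :=
  isHomogeneous_totalDegree_of_dvd (((hhom _).C_mul _).sub ((hhom _).C_mul _)) h0 hdvd

theorem exists_unmixedPart_fiberIdeal_eq_span (hm : 0 < m) (hgcd : IsGCDOf (Set.range f) 1)
    {p : Fin (n + 1) → k} (hp : p ≠ 0) (h0 : ∃ ij, fiberMinor f p ij ≠ 0)
    (hdim : projDim (fiberIdeal f p) = (m - 1 : ℕ)) :
    ∃ h ≠ 0, ¬ IsUnit h ∧ unmixedPart (fiberIdeal f p) = Ideal.span {h} := by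
  obtain ⟨ij, hij⟩ := h0
  obtain ⟨h, hh⟩ := exists_isGCDOf_range (fiberMinor f p)
  have hJ : fiberIdeal f p ≠ ⊥ :=
    Submodule.ne_bot_iff _ |>.2 ⟨_, fiberMinor_mem_fiberIdeal ij, hij⟩
  have hheight (q : MvPolynomial (Fin (m + 1)) k) (hq : Prime q) :=
    ringKrullDim_quotient_span_singleton hq.ne_zero hq.not_isUnit
  have hd := ringKrullDim_quotient_eq_of_projDim hm hJ hdim
  have hgcd' := isGCDOf_fiberIdeal hgcd hp hh
  exact ⟨h, hh.ne_zero ⟨ij, rfl⟩ hij,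
    not_isUnit_of_isGCDOf_of_ringKrullDim_quotient hheight hJ hd hgcd',
    unmixedPart_eq_span_of_isGCDOf hheight hJ hd hgcd'⟩

end Locus

theorem theorem2p5_general {k : Type*} [Field k] {m n d : ℕ}
    (f : Fin (n + 1) → MvPolynomial (Fin (m + 1)) k)
    (hhom : ∀ i, (f i).IsHomogeneous d)
    (hgcd : IsGCDOf (Set.range f) 1)
    (hJ : minorIdeal 3 (jacobianMatrix f) ≠ ⊥)
    (F : MvPolynomial (Fin (m + 1)) k)
    (hF : IsGCDOf (minorSet 3 (jacobianMatrix f)) F) :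
    (fiberDimLocus f (m - 1)).Finite ∧
    (∀ y ∈ fiberDimLocus f (m - 1), ∃ h : MvPolynomial (Fin (m + 1)) k,
      h ≠ 0 ∧ (∃ e : ℕ, h.IsHomogeneous e) ∧
        unmixedPart (fiberIdealAt f y) = Ideal.span {h}) ∧
    F.totalDegree ≤ 3 * (d - 1) ∧
    ∀ (h : Projectivization k (Fin (n + 1) → k) → MvPolynomial (Fin (m + 1)) k)
      (r : Projectivization k (Fin (n + 1) → k) → ℕ)
      (q : ∀ y, Fin (r y) → MvPolynomial (Fin (m + 1)) k)
      (e : ∀ y, Fin (r y) → ℕ),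
      (∀ y ∈ fiberDimLocus f (m - 1), unmixedPart (fiberIdealAt f y) = Ideal.span {h y}) →
      (∀ y ∈ fiberDimLocus f (m - 1), IsIrreducibleFactorization (h y) (q y) (e y)) →
      (∑ᶠ y ∈ fiberDimLocus f (m - 1), (h y).totalDegree) ≤
          (∑ᶠ y ∈ fiberDimLocus f (m - 1), ∑ i, (2 * e y i - 1) * (q y i).totalDegree) ∧
        (∑ᶠ y ∈ fiberDimLocus f (m - 1), ∑ i, (2 * e y i - 1) * (q y i).totalDegree) ≤
          F.totalDegree := by
  obtain ⟨x, hx, hx0⟩ := exists_mem_minorSet_ne_zero hJ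
  have hF0 : F ≠ 0 := hF.ne_zero hx hx0
  have hm : 3 ≤ m + 1 := le_of_mem_minorSet hx
  have hminor (y : Projectivization k (Fin (n + 1) → k)) : ∃ ij, fiberMinor f y.rep ij ≠ 0 :=
    exists_fiberMinor_ne_zero y.rep_nonzero (by lia) hx hx0
  have hspan (y) (hy : y ∈ fiberDimLocus f (m - 1)) :
      ∃ h ≠ 0, ¬ IsUnit h ∧ unmixedPart (fiberIdealAt f y) = Ideal.span {h} :=
    exists_unmixedPart_fiberIdeal_eq_span (by lia) hgcd y.rep_nonzero (hminor y) hy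
  have hfinite : (fiberDimLocus f (m - 1)).Finite :=
    finite_of_exists_not_isUnit_dvd_fiberMinor hgcd le_rfl hF hF0 fun y hy =>
      let ⟨h, h0, hu, hh⟩ := hspan y hy
      ⟨h, h0, hu, dvd_fiberMinor_of_unmixedPart_eq_span hh⟩
  refine ⟨hfinite, fun y hy => ?_, ?_, fun h r q e hh hfac => ?_⟩
  · obtain ⟨h, h0, -, hh⟩ := hspan y hy
    exact ⟨h, h0, ⟨_, isHomogeneous_totalDegree_of_dvd_fiberMinor hhom (hminor y).choose_spec
      (dvd_fiberMinor_of_unmixedPart_eq_span hh _)⟩, hh⟩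
  · exact (totalDegree_le_of_dvd_of_isDomain (hF.1 x hx) hx0).trans
      (isHomogeneous_of_mem_minorSet_jacobianMatrix hhom hx).totalDegree_le
  · simp only [finsum_mem_eq_finite_toFinset_sum _ hfinite]
    simp only [← hfinite.mem_toFinset] at hh hfac
    exact ⟨Finset.sum_le_sum fun y hy => (hfac y hy).totalDegree_le,
      sum_sum_mul_totalDegree_le hgcd hF hF0
        (fun y hy => dvd_fiberMinor_of_unmixedPart_eq_span (hh y hy)) hfac⟩

theorem theorem2p5 {k : Type*} [Field k] [IsAlgClosed k] {m n d : ℕ} (hm : 2 ≤ m)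
    (f : Fin (n + 1) → MvPolynomial (Fin (m + 1)) k)
    (hhom : ∀ i, (f i).IsHomogeneous d)
    (hmin : IsMinimalGenerating f)
    (hgcd : IsGCDOf (Set.range f) 1)
    (hfin : IsGenericallyFinite f)
    (hJ : minorIdeal 3 (jacobianMatrix f) ≠ ⊥)
    (F : MvPolynomial (Fin (m + 1)) k)
    (hF : IsGCDOf (minorSet 3 (jacobianMatrix f)) F) :
    (fiberDimLocus f (m - 1)).Finite ∧
    (∀ y ∈ fiberDimLocus f (m - 1), ∃ h : MvPolynomial (Fin (m + 1)) k,
      h ≠ 0 ∧ (∃ e : ℕ, h.IsHomogeneous e) ∧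
        unmixedPart (fiberIdealAt f y) = Ideal.span {h}) ∧
    F.totalDegree ≤ 3 * (d - 1) ∧
    ∀ (h : Projectivization k (Fin (n + 1) → k) → MvPolynomial (Fin (m + 1)) k)
      (r : Projectivization k (Fin (n + 1) → k) → ℕ)
      (q : ∀ y, Fin (r y) → MvPolynomial (Fin (m + 1)) k)
      (e : ∀ y, Fin (r y) → ℕ),
      (∀ y ∈ fiberDimLocus f (m - 1), unmixedPart (fiberIdealAt f y) = Ideal.span {h y}) →
      (∀ y ∈ fiberDimLocus f (m - 1), IsIrreducibleFactorization (h y) (q y) (e y)) →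
      (∑ᶠ y ∈ fiberDimLocus f (m - 1), (h y).totalDegree) ≤
          (∑ᶠ y ∈ fiberDimLocus f (m - 1), ∑ i, (2 * e y i - 1) * (q y i).totalDegree) ∧
        (∑ᶠ y ∈ fiberDimLocus f (m - 1), ∑ i, (2 * e y i - 1) * (q y i).totalDegree) ≤
          F.totalDegree :=
  theorem2p5_general f hhom hgcd hJ F hF
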